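/- Let $X=\{0,1\}$, let $X^*$ be the infinite rooted binary tree of finite words over $X$, let $\operatorname{Aut}X^*$ be its automorphism group, and let $\psi:\operatorname{Aut}X^*\to \operatorname{Aut}X^*\wr \operatorname{Sym}(X)$ be the wreath decomposition. Let $a=\sigma\in\operatorname{Aut}X^*$ be the automorphism that permutes the two maximal subtrees, and let $b,c,d\in\operatorname{Aut}X^*$ be defined recursively by $$\psi(b)=(c,a),\qquad \psi(c)=(a,d),\qquad \psi(d)=(1,b).$$ Let $G=\langle a,b,c,d\rangle$ (the twisted twin of the Grigorchuk group). Let $K$ be the normal closure in $G$ of $\{[a,b],[b,c],[b,d],[c,d],bcd\}$, and let $C$ be the subgroup generated by $[K,G]$ and $[a,b][b,c]$. For $v\in X^*$ and $g\in\operatorname{Aut}X^*$, let $v*g$ be the automorphism that maps $vw$ to $v\,g(w)$ for all $w\in X^*$ and fixes all words that do not begin with $v$; for a subgroup $H$ and $n\ge 0$, let $X^n*H=\prod_{v\in X^n}v*H$. Then $G$ is just-infinite, that is, $G$ is infinite and every non-trivial normal subgroup of $G$ has finite index in $G$. Moreover, every non-trivial normal subgroup of $G$ contains $X^n*C$ for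 all sufficiently large $n$. -/

import Mathlib

namespace TwistedTwin

open scoped commutatorElement

/-- The automorphism group of the rooted binary tree. Vertices are the finite words over
`X = Bool` (`false` is the letter `0`, `true` is the letter `1`), ordered by the prefix relation;
tree automorphisms are the bijections that preserve and reflect this relation. The product `g * h`
acts by `h` first. -/
abbrev AutTree : Type :=
  RelIso (fun u v : List Bool => u <+: v) (fun u v : List Bool => u <+: v)

/-! ### The generators -/

/-- The states of the automaton that defines the generators (`e` is the identity state). -/
inductive State : Type
  | e | a | b | c | d

/-- The action of a state on the first letter. -/
def State.out : State → Bool → Bool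
  | .a, x => !x
  | _, x => x

/-- The state `q|ₓ` of `q` at the letter `x`:
`ψ(a) = (1,1)σ`, `ψ(b) = (c,a)`, `ψ(c) = (a,d)`, `ψ(d) = (1,b)`. -/
def State.next : State → Bool → State
  | .e, _ => .e
  | .a, _ => .e
  | .b, false => .c
  | .b, true => .a
  | .c, false => .a
  | .c, true => .d
  | .d, false => .e
  | .d, true => .b

/-- The action of a state on words: `q(x w) = q(x) q|ₓ(w)`. -/
def State.act : State → List Bool → List Bool
  | _, [] => []
  | q, x :: w => q.out x :: (q.next x).act w

theorem State.act_act (q : State) (w : List Bool) : q.act (q.act w) = w := by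
  induction w generalizing q with
  | nil => rfl
  | cons x w ih =>
    have h1 : q.out (q.out x) = x := by cases q <;> simp [State.out]
    have h2 : q.next (q.out x) = q.next x := by cases q <;> simp [State.out, State.next]
    simp [State.act, h1, h2, ih]

theorem State.act_prefix (q : State) {u v : List Bool} (h : u <+: v) : q.act u <+: q.act v := by
  induction u generalizing q v with
  | nil => simp [State.act]
  | cons x u ih =>
    cases v with
    | nil => simp at h
    | cons y v =>
      obtain ⟨rfl, huv⟩ := List.cons_prefix_cons.1 h
      exact List.cons_prefix_cons.2 ⟨rfl, ih _ huv⟩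

/-- The tree automorphism defined by a state. -/
def State.toAut (q : State) : AutTree where
  toFun := q.act
  invFun := q.act
  left_inv := q.act_act
  right_inv := q.act_act
  map_rel_iff' := by
    intro u v
    refine ⟨fun h => ?_, fun h => q.act_prefix h⟩
    have h' : q.act (q.act u) <+: q.act (q.act v) := q.act_prefix h
    rwa [q.act_act, q.act_act] at h'

/-- The twisted twin `G = ⟨a, b, c, d⟩` of the Grigorchuk group. -/
def G : Subgroup AutTree :=
  Subgroup.closure {State.a.toAut, State.b.toAut, State.c.toAut, State.d.toAut}

/-- The generator `a`, as an element of `G`. -/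
def a : G := ⟨State.a.toAut, Subgroup.subset_closure (by simp)⟩
/-- The generator `b`, as an element of `G`. -/
def b : G := ⟨State.b.toAut, Subgroup.subset_closure (by simp)⟩
/-- The generator `c`, as an element of `G`. -/
def c : G := ⟨State.c.toAut, Subgroup.subset_closure (by simp)⟩
/-- The generator `d`, as an element of `G`. -/
def d : G := ⟨State.d.toAut, Subgroup.subset_closure (by simp)⟩

/-! ### The subgroups `K` and `C` -/

/-- `K` is the normal closure in `G` of `[a,b], [b,c], [b,d], [c,d], bcd`. -/
def K : Subgroup G :=
  Subgroup.normalClosure {⁅a, b⁆, ⁅b, c⁆, ⁅b, d⁆, ⁅c, d⁆, b * c * d}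

/-- `C` is generated by `[K,G]` and `[a,b][b,c]`. -/
def C : Subgroup G := ⁅K, (⊤ : Subgroup G)⁆ ⊔ Subgroup.zpowers (⁅a, b⁆ * ⁅b, c⁆)

/-! ### Translates `v * g` and `Xⁿ * H` -/

/-- The map that acts as `f` below the letter `x` and fixes all other words. -/
def belowFun (x : Bool) (f : List Bool → List Bool) : List Bool → List Bool
  | [] => []
  | y :: w => if y = x then y :: f w else y :: w

theorem belowFun_prefix (x : Bool) {f : List Bool → List Bool}
    (hf : ∀ u v, u <+: v → f u <+: f v) {u v : List Bool} (h : u <+: v) :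
    belowFun x f u <+: belowFun x f v := by
  cases u with
  | nil => simp [belowFun]
  | cons y u =>
    cases v with
    | nil => simp at h
    | cons z v =>
      obtain ⟨rfl, huv⟩ := List.cons_prefix_cons.1 h
      by_cases hy : y = x
      · simpa [belowFun, hy] using hf u v huv
      · simpa [belowFun, hy] using huv

theorem belowFun_comp (x : Bool) (f g : List Bool → List Bool) (w : List Bool) :
    belowFun x f (belowFun x g w) = belowFun x (fun u => f (g u)) w := by
  cases w with
  | nil => rfl
  | cons y w => by_cases hy : y = x <;> simp [belowFun, hy]

theorem belowFun_id (x : Bool) (w : List Bool) : belowFun x (fun u => u) w = w := by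
  cases w with
  | nil => rfl
  | cons y w => simp [belowFun]

/-- The homomorphism `g ↦ x * g` for a letter `x`. -/
def below (x : Bool) : AutTree →* AutTree where
  toFun g :=
    { toFun := belowFun x g
      invFun := belowFun x g.symm
      left_inv := fun w => by simp [belowFun_comp, belowFun_id]
      right_inv := fun w => by simp [belowFun_comp, belowFun_id]
      map_rel_iff' := by
        intro u v
        refine ⟨fun h => ?_, fun h => belowFun_prefix x (fun _ _ h => g.map_rel_iff.2 h) h⟩
        have h' := belowFun_prefix x (f := g.symm) (fun _ _ h => g.symm.map_rel_iff.2 h) h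
        simpa [belowFun_comp, belowFun_id] using h' }
  map_one' := RelIso.ext fun w => belowFun_id x w
  map_mul' g h := RelIso.ext fun w => (belowFun_comp x g h w).symm

/-- The homomorphism `g ↦ v * g` for a vertex `v`. -/
def translate : List Bool → (AutTree →* AutTree)
  | [] => MonoidHom.id AutTree
  | x :: v => (below x).comp (translate v)

theorem below_cons_same (x : Bool) (g : AutTree) (w : List Bool) :
    below x g (x :: w) = x :: g w := by
  change belowFun x g (x :: w) = _
  simp [belowFun]

/-- The translate `v * g` acts as `g` below `v` ... -/
theorem translate_append (v : List Bool) (g : AutTree) (w : List Bool) :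
    translate v g (v ++ w) = v ++ g w := by
  induction v with
  | nil => rfl
  | cons x v ih =>
    change below x (translate v g) (x :: (v ++ w)) = _
    rw [below_cons_same, ih]
    rfl

/-- ... and fixes every word that does not pass through `v`. -/
theorem translate_of_not_prefix (v : List Bool) (g : AutTree) (w : List Bool)
    (h : ¬ v <+: w) : translate v g w = w := by
  induction v generalizing w with
  | nil => simp at h
  | cons x v ih =>
    change belowFun x (translate v g) w = w
    cases w with
    | nil => rfl
    | cons y w =>
      by_cases hy : y = x
      · subst hy
        have hw : ¬ v <+: w := fun h' => h (List.cons_prefix_cons.2 ⟨rfl, h'⟩)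
        simp [belowFun, ih w hw]
      · simp [belowFun, hy]

/-- `Xⁿ * H = ∏_{v ∈ Xⁿ} v * H`, the product of the (pairwise commuting) subgroups `v * H` over
the vertices `v` of level `n`, as the subgroup that they generate. -/
def levelTranslate (n : ℕ) (H : Subgroup AutTree) : Subgroup AutTree :=
  ⨆ v : {v : List Bool // v.length = n}, H.map (translate v.1)

/-- A group is just-infinite if it is infinite and each of its non-trivial normal subgroups has
finite index. -/
def IsJustInfinite (Γ : Type*) [Group Γ] : Prop :=
  Infinite Γ ∧ ∀ N : Subgroup Γ, N.Normal → N ≠ ⊥ → N.FiniteIndex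

end TwistedTwin

namespace TwistedTwin

open scoped commutatorElement

/-! `K` contains its own translate below the letter `1` (`KAut_le_pull`), and the translate of `C`
even lies in `[K,G]` (`CAut_le_pull_commutator`). Taking sections at `1` three times enlarges `K` to
a group containing `G` (`G_le_sectionSubgroup`). Since `1 * [k,s] = [1 * k, g]` whenever `s` is the
section of `g` at the fixed vertex `1`, these facts push `C` into `[K,K]` four levels down
(`CAut_le_iterate_pull`).

If `g ≠ 1` in a normal subgroup `N` moves the vertex `v`, then `[[v * h, g], v * k] = v * [h,k]` for
`h, k` in `K`, so `N` contains `v * [K,K]`. Hence `N` contains `Xⁿ * C` for all `n ≥ |v| + 4`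
(`exists_levelTranslate_le`).

Finite index of `N` thus reduces to that of `Xⁿ * C`. The quotient `G/K` is finite by explicit
relations, and `K/C` is central in `G/C` and generated by five elements of finite order. Finite
index passes from `H` to `X * H` because the first-level stabiliser in `G` has index two and embeds
in `G × G`. Finally `G` is infinite because `k ↦ 1 * k` is injective but not surjective on `K`. -/

/-! ### Sections of tree automorphisms -/

/-- `g` maps `x w` to `y s(w)` for all words `w`. -/
def HasSection (g : AutTree) (x y : Bool) (s : AutTree) : Prop :=
  ∀ w, g (x :: w) = y :: s w

theorem apply_nil (g : AutTree) : g [] = [] := by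
  have h : g [] <+: g (g.symm []) := g.map_rel_iff.2 List.nil_prefix
  rw [g.apply_symm_apply] at h
  exact List.prefix_nil.1 h

theorem below_cons_ne {x y : Bool} (h : y ≠ x) (g : AutTree) (w : List Bool) :
    below x g (y :: w) = y :: w := by
  change belowFun x g (y :: w) = _
  simp [belowFun, h]

theorem HasSection.mul {g h s t : AutTree} {x y z : Bool} (hg : HasSection g y z s)
    (hh : HasSection h x y t) : HasSection (g * h) x z (s * t) := fun w => by
  rw [RelIso.mul_apply, hh, hg, RelIso.mul_apply]

theorem HasSection.inv {g s : AutTree} {x y : Bool} (hg : HasSection g x y s) :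
    HasSection g⁻¹ y x s⁻¹ := fun w => by
  apply g.injective
  rw [RelIso.apply_inv_self, hg, RelIso.apply_inv_self]

theorem HasSection.conj_below {g s : AutTree} {x y : Bool} (hg : HasSection g x y s)
    (k : AutTree) : g * below x k * g⁻¹ = below y (s * k * s⁻¹) := by
  rw [mul_inv_eq_iff_eq_mul]
  ext1 w
  rw [RelIso.mul_apply, RelIso.mul_apply]
  cases w with
  | nil => simp only [apply_nil]
  | cons z w =>
    by_cases hz : z = x
    · subst hz
      rw [below_cons_same, hg, hg, below_cons_same]
      simp [RelIso.mul_apply]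
    · rw [below_cons_ne hz]
      cases hu : g (z :: w) with
      | nil => rw [apply_nil]
      | cons t u =>
        by_cases ht : t = y
        · subst ht
          have h : g (z :: w) = g (x :: s⁻¹ u) := by
            rw [hu, hg, RelIso.apply_inv_self]
          exact absurd (List.cons_eq_cons.1 (g.injective h)).1 hz
        · rw [below_cons_ne ht]

/-- Conjugating `x * k` by `g` only sees the section of `g` at `x`, so the other section of `g` is
irrelevant. All later computations of translated commutators rest on this. -/
theorem HasSection.below_commutator {g s : AutTree} {x : Bool} (hg : HasSection g x x s)
    (k : AutTree) : below x ⁅k, s⁆ = ⁅below x k, g⁆ := by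
  have h := hg.conj_below k⁻¹
  rw [commutatorElement_def, commutatorElement_def, mul_assoc, mul_assoc, ← mul_assoc s,
    map_mul, ← h, map_inv]
  simp only [mul_assoc]

theorem HasSection.below_commutator' {g s : AutTree} {x : Bool} (hg : HasSection g x x s)
    (k : AutTree) : below x ⁅s, k⁆ = ⁅g, below x k⁆ := by
  rw [← commutatorElement_inv, map_inv, hg.below_commutator, commutatorElement_inv]

theorem State.hasSection (q : State) (x : Bool) :
    HasSection q.toAut x (q.out x) (q.next x).toAut := fun _ => rfl

theorem State.toAut_e : State.e.toAut = 1 := by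
  ext1 w
  change State.e.act w = w
  induction w with
  | nil => rfl
  | cons x w ih => simp [State.act, State.out, State.next, ih]

theorem State.toAut_mul_self (q : State) : q.toAut * q.toAut = 1 :=
  RelIso.ext q.act_act

theorem State.toAut_inv (q : State) : q.toAut⁻¹ = q.toAut :=
  inv_eq_of_mul_eq_one_left q.toAut_mul_self

theorem hasSection_a (x : Bool) : HasSection State.a.toAut x (!x) 1 :=
  State.toAut_e ▸ State.a.hasSection x

theorem hasSection_b_false : HasSection State.b.toAut false false State.c.toAut :=
  State.b.hasSection false
theorem hasSection_b_true : HasSection State.b.toAut true true State.a.toAut :=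
  State.b.hasSection true
theorem hasSection_c_false : HasSection State.c.toAut false false State.a.toAut :=
  State.c.hasSection false
theorem hasSection_c_true : HasSection State.c.toAut true true State.d.toAut :=
  State.c.hasSection true
theorem hasSection_d_false : HasSection State.d.toAut false false 1 :=
  State.toAut_e ▸ State.d.hasSection false
theorem hasSection_d_true : HasSection State.d.toAut true true State.b.toAut :=
  State.d.hasSection true

/-- Conjugation by `a` interchanges the sections. -/
theorem HasSection.conj_a {g s : AutTree} {x y : Bool} (hg : HasSection g (!x) (!y) s) :
    HasSection (State.a.toAut * g * State.a.toAut) x y s := by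
  simpa using ((hasSection_a (!y)).mul hg).mul (hasSection_a x)

theorem ext_sections {g h s t : AutTree} {y z : Bool} (hg0 : HasSection g false y s)
    (hh0 : HasSection h false y s) (hg1 : HasSection g true z t) (hh1 : HasSection h true z t) :
    g = h := by
  ext1 w
  match w with
  | [] => rw [apply_nil, apply_nil]
  | false :: w => rw [hg0, hh0]
  | true :: w => rw [hg1, hh1]

theorem hasSection_below_same (x : Bool) (g : AutTree) : HasSection (below x g) x x g :=
  below_cons_same x g

theorem hasSection_below_ne {x y : Bool} (h : y ≠ x) (g : AutTree) :
    HasSection (below x g) y y 1 :=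
  below_cons_ne h g

/-- This identity and the next one express translates of elements of `G` as elements of `G`; they
suffice to translate all five generators of `K`. -/
theorem below_true_b : below true State.b.toAut = State.d.toAut :=
  ext_sections (hasSection_below_ne (by decide) _) hasSection_d_false
    (hasSection_below_same _ _) hasSection_d_true

theorem below_true_c_mul_d : below true (State.c.toAut * State.d.toAut) =
    State.a.toAut * State.b.toAut * State.a.toAut * State.c.toAut := by
  refine ext_sections (hasSection_below_ne (by decide) _) ?_ (hasSection_below_same _ _) ?_
  · rw [← State.a.toAut_mul_self]
    exact (hasSection_b_true.conj_a (x := false) (y := false)).mul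
      hasSection_c_false
  · exact (hasSection_b_false.conj_a (x := true) (y := true)).mul
      hasSection_c_true

/-! ### Subgroups normalised by `G` -/

theorem toAut_mem_G (q : State) : q.toAut ∈ G := by
  cases q
  · exact State.toAut_e ▸ one_mem G
  · exact a.2
  · exact b.2
  · exact c.2
  · exact d.2

/-- Every element of `G` is a section of an element of `G`. -/
theorem exists_hasSection_true {s : AutTree} (hs : s ∈ G) :
    ∃ g ∈ G, HasSection g true true s := by
  induction hs using Subgroup.closure_induction with
  | mem s hs =>
    simp only [Set.mem_insert_iff, Set.mem_singleton_iff] at hs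
    rcases hs with rfl | rfl | rfl | rfl
    · exact ⟨_, toAut_mem_G .b, hasSection_b_true⟩
    · exact ⟨_, toAut_mem_G .d, hasSection_d_true⟩
    · exact ⟨_, mul_mem (mul_mem (toAut_mem_G .a) (toAut_mem_G .b)) (toAut_mem_G .a),
        hasSection_b_false.conj_a⟩
    · exact ⟨_, toAut_mem_G .c, hasSection_c_true⟩
  | one => exact ⟨1, one_mem _, fun _ => rfl⟩
  | mul s t _ _ hs ht =>
    obtain ⟨g, hg, hgs⟩ := hs
    obtain ⟨h, hh, hht⟩ := ht
    exact ⟨g * h, mul_mem hg hh, hgs.mul hht⟩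
  | inv s _ hs =>
    obtain ⟨g, hg, hgs⟩ := hs
    exact ⟨g⁻¹, inv_mem hg, hgs.inv⟩

/-- The sections of elements of `G` lie in `G`. -/
theorem exists_section_mem {g : AutTree} (hg : g ∈ G) (x : Bool) :
    ∃ y, ∃ s ∈ G, HasSection g x y s := by
  induction hg using Subgroup.closure_induction generalizing x with
  | mem g hg =>
    simp only [Set.mem_insert_iff, Set.mem_singleton_iff] at hg
    rcases hg with rfl | rfl | rfl | rfl <;>
      exact ⟨_, _, toAut_mem_G _, State.hasSection _ x⟩
  | one => exact ⟨x, 1, one_mem _, fun _ => rfl⟩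
  | mul g h _ _ hg hh =>
    obtain ⟨y, t, ht, hht⟩ := hh x
    obtain ⟨z, s, hs, hgs⟩ := hg y
    exact ⟨z, s * t, mul_mem hs ht, hgs.mul hht⟩
  | inv g _ hg =>
    obtain ⟨y, s, hs, hgs⟩ := hg x
    obtain ⟨z, t, ht, hgt⟩ := hg (!x)
    have hyz : y ≠ z := by
      rintro rfl
      have h : g (x :: s⁻¹ []) = g ((!x) :: t⁻¹ []) := by
        rw [hgs, hgt, RelIso.apply_inv_self, RelIso.apply_inv_self]
      have := (List.cons_eq_cons.1 (g.injective h)).1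
      cases x <;> cases this
    by_cases hx : x = y
    · subst hx
      exact ⟨x, _, inv_mem hs, hgs.inv⟩
    · have hz : x = z := by
        revert hx hyz
        cases x <;> cases y <;> cases z <;> decide
      subst hz
      exact ⟨!x, _, inv_mem ht, hgt.inv⟩

/-- `M` is normalised by `G`. -/
def IsGInvariant (M : Subgroup AutTree) : Prop :=
  ∀ g ∈ G, ∀ m ∈ M, g * m * g⁻¹ ∈ M

theorem isGInvariant_map {N : Subgroup G} (hN : N.Normal) : IsGInvariant (N.map G.subtype) := by
  rintro g hg _ ⟨m, hm, rfl⟩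
  exact ⟨⟨g, hg⟩ * m * ⟨g, hg⟩⁻¹, hN.conj_mem m hm _, rfl⟩

theorem IsGInvariant.comap_normal {M : Subgroup AutTree} (hM : IsGInvariant M) :
    (M.comap G.subtype).Normal :=
  ⟨fun m hm g => hM g g.2 m hm⟩

theorem IsGInvariant.commutator {M N : Subgroup AutTree} (hM : IsGInvariant M)
    (hN : IsGInvariant N) : IsGInvariant ⁅M, N⁆ := by
  intro g hg m hm
  have h : ⁅M, N⁆ ≤ ⁅M, N⁆.comap (MulAut.conj g).toMonoidHom := by
    rw [Subgroup.commutator_le]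
    intro p hp q hq
    rw [Subgroup.mem_comap, map_commutatorElement]
    exact Subgroup.commutator_mem_commutator (hM g hg p hp) (hN g hg q hq)
  exact h hm

theorem isGInvariant_G : IsGInvariant G :=
  fun _ hg _ hm => mul_mem (mul_mem hg hm) (inv_mem hg)

/-- The elements `h` such that `M` contains the translate of `h` below the letter `1`. -/
def pull (M : Subgroup AutTree) : Subgroup AutTree :=
  M.comap (below true)

theorem mem_pull {M : Subgroup AutTree} {h : AutTree} : h ∈ pull M ↔ below true h ∈ M := Iff.rfl

theorem pull_mono : Monotone pull :=
  fun _ _ h => Subgroup.comap_mono h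

theorem IsGInvariant.pull {M : Subgroup AutTree} (hM : IsGInvariant M) :
    IsGInvariant (pull M) := by
  intro s hs m hm
  obtain ⟨g, hg, hgs⟩ := exists_hasSection_true hs
  change below true (s * m * s⁻¹) ∈ M
  rw [← hgs.conj_below]
  exact hM g hg _ hm

theorem IsGInvariant.comap_below {M : Subgroup AutTree} (hM : IsGInvariant M) (x : Bool) :
    M.comap (below x) = TwistedTwin.pull M := by
  cases x with
  | true => rfl
  | false =>
    ext m
    change below false m ∈ M ↔ below true m ∈ M
    constructor
    · intro h
      simpa [(hasSection_a false).conj_below] using hM _ (toAut_mem_G .a) _ h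
    · intro h
      simpa [(hasSection_a true).conj_below] using hM _ (toAut_mem_G .a) _ h

/-- Conjugation by `a` interchanges the two letters, and `pull` preserves invariance, so only the
length of `v` matters. Hence it is enough to work below the letter `1`. -/
theorem IsGInvariant.comap_translate {M : Subgroup AutTree} (hM : IsGInvariant M)
    (v : List Bool) : M.comap (translate v) = TwistedTwin.pull^[v.length] M := by
  induction v generalizing M with
  | nil => exact Subgroup.comap_id M
  | cons x v ih =>
    change M.comap ((below x).comp (translate v)) = _
    rw [← Subgroup.comap_comap, hM.comap_below, ih hM.pull]
    rfl

/-- The sections at the vertex `1` of the elements of `L` that fix this vertex. -/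
def sectionSubgroup (L : Subgroup AutTree) : Subgroup AutTree where
  carrier := {s | ∃ g ∈ L, HasSection g true true s}
  one_mem' := ⟨1, one_mem _, fun _ => rfl⟩
  mul_mem' := by
    rintro s t ⟨g, hg, hgs⟩ ⟨h, hh, hht⟩
    exact ⟨g * h, mul_mem hg hh, hgs.mul hht⟩
  inv_mem' := by
    rintro s ⟨g, hg, hgs⟩
    exact ⟨g⁻¹, inv_mem hg, hgs.inv⟩

theorem commutator_sectionSubgroup_le {M : Subgroup AutTree} (hM : M ≤ pull M)
    (L : Subgroup AutTree) : ⁅M, sectionSubgroup L⁆ ≤ pull ⁅M, L⁆ := by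
  rw [Subgroup.commutator_le]
  rintro k hk s ⟨g, hg, hgs⟩
  rw [mem_pull, hgs.below_commutator]
  exact Subgroup.commutator_mem_commutator (hM hk) hg

theorem IsGInvariant.sectionSubgroup {L : Subgroup AutTree} (hL : IsGInvariant L) :
    IsGInvariant (sectionSubgroup L) := by
  rintro s hs t ⟨h, hh, hht⟩
  obtain ⟨g, hg, hgs⟩ := exists_hasSection_true hs
  exact ⟨g * h * g⁻¹, hL g hg h hh, (hgs.mul hht).mul hgs.inv⟩

/-! ### Relations in `G` -/

theorem a_mul_self : a * a = 1 := Subtype.ext State.a.toAut_mul_self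
theorem b_mul_self : b * b = 1 := Subtype.ext State.b.toAut_mul_self
theorem c_mul_self : c * c = 1 := Subtype.ext State.c.toAut_mul_self
theorem d_mul_self : d * d = 1 := Subtype.ext State.d.toAut_mul_self

theorem closure_generators : Subgroup.closure ({a, b, c, d} : Set G) = ⊤ := by
  apply Subgroup.map_injective G.subtype_injective
  rw [MonoidHom.map_closure, ← MonoidHom.range_eq_map, Subgroup.range_subtype]
  simp only [Set.image_insert_eq, Set.image_singleton]
  rfl

theorem below_commutator_a_b :
    below true ⁅State.a.toAut, State.b.toAut⁆ = ⁅State.b.toAut, State.d.toAut⁆ := by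
  rw [hasSection_b_true.below_commutator', below_true_b]

/-- Both `aca` and `b` have section `a` at `1`, and `d = 1 * b`, so both sides are `1 * [a,b]`. This
supplies the relation `(ca)⁴ = 1` modulo `K`. -/
theorem commutator_aca_d : ⁅a * c * a, d⁆ = ⁅b, d⁆ := by
  apply Subtype.ext
  refine Eq.trans ?_ below_commutator_a_b
  have h := (hasSection_c_false.conj_a (x := true) (y := true)).below_commutator'
    State.b.toAut
  rw [below_true_b] at h
  exact h.symm

theorem commutator_a_b_mem_K : ⁅a, b⁆ ∈ K := Subgroup.subset_normalClosure (by simp)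
theorem commutator_b_c_mem_K : ⁅b, c⁆ ∈ K := Subgroup.subset_normalClosure (by simp)
theorem commutator_b_d_mem_K : ⁅b, d⁆ ∈ K := Subgroup.subset_normalClosure (by simp)
theorem commutator_c_d_mem_K : ⁅c, d⁆ ∈ K := Subgroup.subset_normalClosure (by simp)
theorem b_mul_c_mul_d_mem_K : b * c * d ∈ K := Subgroup.subset_normalClosure (by simp)

instance : K.Normal := Subgroup.normalClosure_normal

theorem mk_eq_one {N : Subgroup G} [N.Normal] {g : G} :
    QuotientGroup.mk' N g = 1 ↔ g ∈ N :=
  QuotientGroup.eq_one_iff g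

theorem commute_mk {N : Subgroup G} [N.Normal] {g h : G} :
    Commute (QuotientGroup.mk' N g) (QuotientGroup.mk' N h) ↔ ⁅g, h⁆ ∈ N := by
  rw [← mk_eq_one, map_commutatorElement, commutatorElement_eq_one_iff_commute]

theorem mk_a_b_a : QuotientGroup.mk' K (a * b * a) = QuotientGroup.mk' K b := by
  have h := (commute_mk.2 commutator_a_b_mem_K).eq
  rw [map_mul, map_mul, h, mul_assoc, ← map_mul, a_mul_self, map_one, mul_one]

theorem commutator_d_aba_mem_K : ⁅d, a * b * a⁆ ∈ K := by
  rw [← commute_mk, mk_a_b_a]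
  exact (commute_mk.2 commutator_b_d_mem_K).symm

theorem commutator_abac_aba_mem_K : ⁅a * b * a * c, a * b * a⁆ ∈ K := by
  rw [← commute_mk, map_mul, mk_a_b_a]
  exact (Commute.refl _).mul_left (commute_mk.2 commutator_b_c_mem_K).symm

theorem d_mul_abac_mem_K : d * (a * b * a * c) ∈ K := by
  rw [← mk_eq_one, map_mul, map_mul, mk_a_b_a, ← map_mul, ← map_mul, mk_eq_one]
  have h := Subgroup.Normal.conj_mem inferInstance _ b_mul_c_mul_d_mem_K d
  rwa [mul_assoc, mul_assoc (b * c), mul_inv_cancel, mul_one] at h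

/-! ### Branching -/

/-- The image of `K` in the automorphism group of the tree. -/
abbrev KAut : Subgroup AutTree := K.map G.subtype

/-- The image of `C` in the automorphism group of the tree. -/
abbrev CAut : Subgroup AutTree := C.map G.subtype

theorem isGInvariant_KAut : IsGInvariant KAut := isGInvariant_map inferInstance

theorem KAut_le {M : Subgroup AutTree} (hM : IsGInvariant M)
    (h1 : ⁅State.a.toAut, State.b.toAut⁆ ∈ M) (h2 : ⁅State.b.toAut, State.c.toAut⁆ ∈ M)
    (h3 : ⁅State.b.toAut, State.d.toAut⁆ ∈ M) (h4 : ⁅State.c.toAut, State.d.toAut⁆ ∈ M)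
    (h5 : State.b.toAut * State.c.toAut * State.d.toAut ∈ M) : KAut ≤ M := by
  have := hM.comap_normal
  rw [Subgroup.map_le_iff_le_comap]
  apply Subgroup.normalClosure_le_normal
  rintro g (rfl | rfl | rfl | rfl | rfl)
  exacts [h1, h2, h3, h4, h5]

/-- The translates of the five generators are `[b,d]`, `[d,aba]`, `[d,c]`, `[abac,aba]` and
`d·abac`. They lie in `K` because `aba` and `b` agree modulo `K`. -/
theorem KAut_le_pull : KAut ≤ pull KAut := by
  apply KAut_le isGInvariant_KAut.pull
  · rw [mem_pull, below_commutator_a_b]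
    exact ⟨_, commutator_b_d_mem_K, rfl⟩
  · rw [mem_pull, (hasSection_b_false.conj_a (x := true) (y := true)).below_commutator,
      below_true_b]
    exact ⟨_, commutator_d_aba_mem_K, rfl⟩
  · rw [mem_pull, hasSection_c_true.below_commutator, below_true_b, ← commutatorElement_inv]
    exact inv_mem ⟨_, commutator_c_d_mem_K, rfl⟩
  · rw [mem_pull]
    -- The translate of `cd` is known to be `abac`, hence the rewriting with `cd` as an entry of the
    -- commutator.
    have h : ⁅State.c.toAut, State.d.toAut⁆ = ⁅State.c.toAut * State.d.toAut, State.c.toAut⁆ := by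
      simp only [commutatorElement_def, mul_inv_rev, State.toAut_inv, mul_assoc]
      rw [State.toAut_mul_self, mul_one]
    rw [h, (hasSection_b_false.conj_a (x := true) (y := true)).below_commutator,
      below_true_c_mul_d]
    exact ⟨_, commutator_abac_aba_mem_K, rfl⟩
  · rw [mem_pull, mul_assoc, map_mul, below_true_b, below_true_c_mul_d]
    exact ⟨_, d_mul_abac_mem_K, rfl⟩

theorem commutator_KAut_G_le_pull : ⁅KAut, G⁆ ≤ pull ⁅KAut, G⁆ :=
  (Subgroup.commutator_mono le_rfl fun _ hs => exists_hasSection_true hs).trans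
    (commutator_sectionSubgroup_le KAut_le_pull G)

theorem map_commutator_K_top : (⁅K, ⊤⁆ : Subgroup G).map G.subtype = ⁅KAut, G⁆ := by
  rw [Subgroup.map_commutator, ← MonoidHom.range_eq_map, Subgroup.range_subtype]

/-- Modulo `[K,G]` the element `[a,b]` is central, and `aba = [a,b]b`, so `[d,aba]` becomes `[d,b] =
[b,d]⁻¹`. -/
theorem commutator_b_d_mul_commutator_d_aba_mem :
    ⁅b, d⁆ * ⁅d, a * b * a⁆ ∈ ⁅K, (⊤ : Subgroup G)⁆ := by
  have ht : ∀ g, Commute (QuotientGroup.mk' ⁅K, (⊤ : Subgroup G)⁆ ⁅a, b⁆)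
      (QuotientGroup.mk' ⁅K, (⊤ : Subgroup G)⁆ g) := fun g => commute_mk.2
    (Subgroup.commutator_mem_commutator commutator_a_b_mem_K (Subgroup.mem_top g))
  have h : a * b * a = ⁅a, b⁆ * b := by
    simp [commutatorElement_def, ← eq_inv_of_mul_eq_one_left a_mul_self]
  rw [← mk_eq_one, map_mul, ← commutatorElement_inv, map_inv, inv_mul_eq_one, h,
    map_commutatorElement, map_commutatorElement, map_mul]
  have h1 := ht d
  set t := QuotientGroup.mk' ⁅K, (⊤ : Subgroup G)⁆ ⁅a, b⁆
  set q := QuotientGroup.mk' ⁅K, (⊤ : Subgroup G)⁆ b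
  set s := QuotientGroup.mk' ⁅K, (⊤ : Subgroup G)⁆ d
  rw [commutatorElement_def, commutatorElement_def, mul_inv_rev, ← mul_assoc s t, ← h1.eq]
  have h2 : t * (s * q * s⁻¹ * q⁻¹) = (s * q * s⁻¹ * q⁻¹) * t := by
    have h := (ht (d * b * d⁻¹ * b⁻¹)).eq
    simp only [map_mul, map_inv] at h
    exact h
  rw [show t * s * q * s⁻¹ * (q⁻¹ * t⁻¹) = t * (s * q * s⁻¹ * q⁻¹) * t⁻¹ by group, h2]
  group

theorem CAut_eq : CAut = ⁅KAut, G⁆ ⊔ Subgroup.zpowers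
    (⁅State.a.toAut, State.b.toAut⁆ * ⁅State.b.toAut, State.c.toAut⁆) := by
  rw [CAut, C, Subgroup.map_sup, map_commutator_K_top, MonoidHom.map_zpowers]
  rfl

theorem commutator_KAut_G_le_CAut : ⁅KAut, G⁆ ≤ CAut := CAut_eq ▸ le_sup_left

/-- The extra generator `[a,b][b,c]` of `C` translates to `[b,d][d,aba]`. -/
theorem CAut_le_pull_commutator : CAut ≤ pull ⁅KAut, G⁆ := by
  rw [CAut_eq, sup_le_iff, Subgroup.zpowers_le]
  refine ⟨commutator_KAut_G_le_pull, ?_⟩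
  rw [mem_pull, map_mul, below_commutator_a_b,
    (hasSection_b_false.conj_a (x := true) (y := true)).below_commutator, below_true_b,
    ← map_commutator_K_top]
  exact ⟨_, commutator_b_d_mul_commutator_d_aba_mem, rfl⟩

theorem CAut_le_pull : CAut ≤ pull CAut :=
  CAut_le_pull_commutator.trans (pull_mono commutator_KAut_G_le_CAut)

/-! ### The commutator subgroup of `K` -/

theorem IsGInvariant.mul_mem_swap {M : Subgroup AutTree} (hM : IsGInvariant M) {g h : AutTree}
    (hg : g ∈ G) (hm : h * g ∈ M) : g * h ∈ M := by
  simpa [mul_assoc] using hM g hg _ hm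

/-- Sections at `1` of `[a,b]` and `bcd`, the seeds for recovering all of `G`. -/
theorem mem_sectionSubgroup_KAut :
    State.c.toAut * State.a.toAut ∈ sectionSubgroup KAut ∧
      State.a.toAut * State.d.toAut * State.b.toAut ∈ sectionSubgroup KAut := by
  constructor
  · refine ⟨_, ⟨_, commutator_a_b_mem_K, rfl⟩, ?_⟩
    change HasSection ⁅State.a.toAut, State.b.toAut⁆ _ _ _
    rw [commutatorElement_def, State.toAut_inv, State.toAut_inv]
    exact (hasSection_b_false.conj_a (x := true) (y := true)).mul hasSection_b_true
  · exact ⟨_, ⟨_, b_mul_c_mul_d_mem_K, rfl⟩,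
      (hasSection_b_true.mul hasSection_c_true).mul hasSection_d_true⟩

theorem mem_sectionSubgroup_sectionSubgroup_KAut :
    State.b.toAut ∈ sectionSubgroup (sectionSubgroup KAut) ∧
    State.d.toAut * State.a.toAut ∈ sectionSubgroup (sectionSubgroup KAut) ∧
      State.a.toAut * State.c.toAut ∈ sectionSubgroup (sectionSubgroup KAut) := by
  obtain ⟨hca, hadb⟩ := mem_sectionSubgroup_KAut
  have hG := isGInvariant_KAut.sectionSubgroup
  have hcdb : State.c.toAut * State.d.toAut * State.b.toAut ∈ sectionSubgroup KAut := by
    have h := mul_mem hca hadb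
    rwa [mul_assoc State.a.toAut, mul_assoc, ← mul_assoc State.a.toAut, State.toAut_mul_self,
      one_mul, ← mul_assoc] at h
  have hda : State.d.toAut * State.a.toAut ∈ sectionSubgroup (sectionSubgroup KAut) := by
    -- `(ca)² = c·aca` fixes the first level and has section `da` at `1`.
    refine ⟨_, mul_mem hca hca, ?_⟩
    have h := hasSection_c_true.mul
      (hasSection_c_false.conj_a (x := true) (y := true))
    simpa only [mul_assoc] using h
  have hdba : State.d.toAut * State.b.toAut * State.a.toAut ∈
      sectionSubgroup (sectionSubgroup KAut) :=
    ⟨_, hcdb, (hasSection_c_true.mul hasSection_d_true).mul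
      hasSection_b_true⟩
  refine ⟨?_, hda, ?_⟩
  -- `b = (da)(adb)`, where `adb` is the conjugate of `dba` by `a`.
  · have h := mul_mem hda (hG.sectionSubgroup.mul_mem_swap (toAut_mem_G .a) hdba)
    rw [mul_assoc, ← mul_assoc State.a.toAut, State.toAut_mul_self, one_mul, ← mul_assoc,
      State.toAut_mul_self, one_mul] at h
    exact h
  · refine ⟨_, hG _ (toAut_mem_G .a) _ hcdb, ?_⟩
    rw [State.toAut_inv]
    have h := ((hasSection_c_false.mul hasSection_d_false).mul
      hasSection_b_false).conj_a (x := true) (y := true)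
    rw [mul_one] at h
    exact h

theorem G_le_sectionSubgroup :
    G ≤ sectionSubgroup (sectionSubgroup (sectionSubgroup KAut)) := by
  obtain ⟨hb, hda, hac⟩ := mem_sectionSubgroup_sectionSubgroup_KAut
  have hG := isGInvariant_KAut.sectionSubgroup.sectionSubgroup
  have hb' : State.b.toAut ∈ sectionSubgroup (sectionSubgroup (sectionSubgroup KAut)) := by
    -- `(da)² = d·ada` has section `b` at `1`; below, `(da)(ac) = dc` has section `bd`.
    refine ⟨_, mul_mem hda hda, ?_⟩
    have h := hasSection_d_true.mul
      (hasSection_d_false.conj_a (x := true) (y := true))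
    rw [mul_one] at h
    simpa only [mul_assoc] using h
  have hbd : State.b.toAut * State.d.toAut ∈
      sectionSubgroup (sectionSubgroup (sectionSubgroup KAut)) := by
    refine ⟨_, mul_mem hda hac, ?_⟩
    rw [mul_assoc, ← mul_assoc State.a.toAut, State.toAut_mul_self, one_mul]
    exact hasSection_d_true.mul hasSection_c_true
  rw [G, Subgroup.closure_le]
  rintro g (rfl | rfl | rfl | rfl)
  · exact ⟨_, hb, hasSection_b_true⟩
  · exact hb'
  · refine ⟨_, hG _ (toAut_mem_G .a) _ hb, ?_⟩
    rw [State.toAut_inv]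
    exact hasSection_b_false.conj_a
  · exact (mul_mem_cancel_left hb').1 hbd

/-- One level takes `C` into `[K,G]`; each of three more trades one layer of sections in the second
entry for a translate, until `G` has been replaced by `K`. -/
theorem CAut_le_iterate_pull : CAut ≤ pull^[4] ⁅KAut, KAut⁆ := by
  have h (L) := commutator_sectionSubgroup_le KAut_le_pull L
  calc
    CAut ≤ pull ⁅KAut, G⁆ := CAut_le_pull_commutator
    _ ≤ pull ⁅KAut, sectionSubgroup (sectionSubgroup (sectionSubgroup KAut))⁆ :=
      pull_mono (Subgroup.commutator_mono le_rfl G_le_sectionSubgroup)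
    _ ≤ pull (pull ⁅KAut, sectionSubgroup (sectionSubgroup KAut)⁆) := pull_mono (h _)
    _ ≤ pull (pull (pull ⁅KAut, sectionSubgroup KAut⁆)) := pull_mono (pull_mono (h _))
    _ ≤ pull^[4] ⁅KAut, KAut⁆ := pull_mono (pull_mono (pull_mono (h _)))

/-! ### Normal subgroups -/

theorem length_apply {g : AutTree} (hg : g ∈ G) (v : List Bool) : (g v).length = v.length := by
  induction v generalizing g with
  | nil => rw [apply_nil]
  | cons x v ih =>
    obtain ⟨y, s, hs, hgs⟩ := exists_section_mem hg x
    rw [hgs, List.length_cons, List.length_cons, ih hs]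

theorem prefix_apply_translate {v : List Bool} (h : AutTree) {w : List Bool} (hw : v <+: w) :
    v <+: translate v h w := by
  obtain ⟨u, rfl⟩ := hw
  rw [translate_append]
  exact List.prefix_append v _

/-- The translate below `v` commutes with the conjugates of translates below `v` by elements that
move `v`. -/
theorem commute_translate_conj {g : AutTree} (hg : g ∈ G) {v : List Bool} (hv : g v ≠ v)
    (h k : AutTree) : Commute (translate v h) (g * translate v k * g⁻¹) := by
  have hfix : ∀ w, v <+: w → (g * translate v k * g⁻¹) w = w := by
    intro w hw
    rw [RelIso.mul_apply, RelIso.mul_apply, translate_of_not_prefix, RelIso.apply_inv_self]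
    intro hw'
    have h1 : g v <+: w := by
      simpa [RelIso.apply_inv_self] using g.map_rel_iff.2 hw'
    -- `v` and `g v` have equal length, so both can be prefixes of `w` only if they coincide.
    exact hv ((List.prefix_of_prefix_length_le h1 hw (length_apply hg v).le).eq_of_length
      (length_apply hg v))
  ext1 w
  rw [RelIso.mul_apply, RelIso.mul_apply (g * translate v k * g⁻¹)]
  by_cases hw : v <+: w
  · rw [hfix w hw, hfix _ (prefix_apply_translate h hw)]
  · rw [translate_of_not_prefix v h w hw, translate_of_not_prefix]
    intro hw'
    exact hw (by rwa [(g * translate v k * g⁻¹).injective (hfix _ hw')] at hw')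

/-- The element `[v * h, g]` of `N` is `v * h` times a factor supported below `g v`. That factor
commutes with `v * k`, so a further commutator with `v * k` leaves `v * [h,k]`. -/
theorem commutator_mem_comap_translate {N : Subgroup AutTree} (hN : IsGInvariant N)
    {g : AutTree} (hg : g ∈ G) (hgN : g ∈ N) {v : List Bool} (hv : g v ≠ v) {h k : AutTree}
    (hh : translate v h ∈ G) (hk : translate v k ∈ G) : ⁅h, k⁆ ∈ N.comap (translate v) := by
  have h1 : ⁅translate v h, g⁆ ∈ N := by
    rw [commutatorElement_def]
    exact mul_mem (hN _ hh _ hgN) (inv_mem hgN)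
  have h2 : ⁅⁅translate v h, g⁆, translate v k⁆ ∈ N := by
    rw [commutatorElement_def, mul_assoc, mul_assoc, ← mul_assoc (translate v k)]
    exact mul_mem h1 (hN _ hk _ (inv_mem h1))
  have h3 : ⁅translate v h, g⁆ = translate v h * (g * translate v h⁻¹ * g⁻¹) := by
    rw [commutatorElement_def, map_inv]
    simp only [mul_assoc]
  have h4 := commute_translate_conj hg hv k h⁻¹
  rw [Subgroup.mem_comap, map_commutatorElement]
  rw [h3] at h2
  set B := g * translate v h⁻¹ * g⁻¹
  convert h2 using 1
  rw [commutatorElement_def, commutatorElement_def, mul_inv_rev, mul_assoc (translate v h) B,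
    ← h4.eq]
  group

theorem KAut_le_G : KAut ≤ G := Subgroup.map_subtype_le K

theorem KAut_le_iterate_pull (n : ℕ) : KAut ≤ pull^[n] KAut := by
  induction n with
  | zero => exact le_rfl
  | succ n ih =>
    rw [Function.iterate_succ_apply]
    exact ih.trans (pull_mono.iterate n KAut_le_pull)

theorem CAut_le_iterate_pull_self (n : ℕ) : CAut ≤ pull^[n] CAut := by
  induction n with
  | zero => exact le_rfl
  | succ n ih =>
    rw [Function.iterate_succ_apply]
    exact ih.trans (pull_mono.iterate n CAut_le_pull)

theorem levelTranslate_le {N H : Subgroup AutTree} (hN : IsGInvariant N) {n : ℕ}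
    (h : H ≤ pull^[n] N) : levelTranslate n H ≤ N := by
  apply iSup_le
  rintro ⟨v, rfl⟩
  rw [Subgroup.map_le_iff_le_comap, hN.comap_translate]
  exact h

theorem exists_levelTranslate_le {N : Subgroup G} (hN : N.Normal) (hN' : N ≠ ⊥) :
    ∃ n₀ : ℕ, ∀ n : ℕ, n₀ ≤ n → levelTranslate n CAut ≤ N.map G.subtype := by
  obtain ⟨g, hg, hg1⟩ := N.bot_or_exists_ne_one.resolve_left hN'
  have hinv := isGInvariant_map hN
  have hg1' : (g : AutTree) ≠ 1 := fun h => hg1 (Subtype.ext h)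
  obtain ⟨v, hv⟩ : ∃ v, (g : AutTree) v ≠ v := by
    by_contra! hv
    exact hg1' (RelIso.ext hv)
  have hK : KAut ≤ G.comap (translate v) := by
    rw [isGInvariant_G.comap_translate]
    exact (KAut_le_iterate_pull _).trans (pull_mono.iterate _ KAut_le_G)
  have hKN : ⁅KAut, KAut⁆ ≤ pull^[v.length] (N.map G.subtype) := by
    rw [← hinv.comap_translate, Subgroup.commutator_le]
    exact fun h hh k hk => commutator_mem_comap_translate hinv g.2 ⟨g, hg, rfl⟩ hv
      (hK hh) (hK hk)
  -- `|v|` levels bring `[K,K]` into `N`, four more bring `C` into `[K,K]`, and any surplus `m` is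
  -- absorbed by `C ≤ pull^[m] C`.
  refine ⟨v.length + 4, fun n hn => levelTranslate_le hinv ?_⟩
  obtain ⟨m, rfl⟩ := Nat.exists_eq_add_of_le' hn
  rw [show m + (v.length + 4) = m + (4 + v.length) by omega, Function.iterate_add_apply,
    Function.iterate_add_apply]
  exact (CAut_le_iterate_pull_self m).trans (pull_mono.iterate m
    (CAut_le_iterate_pull.trans (pull_mono.iterate 4 hKN)))

/-! ### Finite index -/

section Finiteness

variable {H : Type*} [Group H]

theorem isOfFinOrder_of_mul_self {x : H} (hx : x * x = 1) : IsOfFinOrder x :=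
  isOfFinOrder_iff_pow_eq_one.2 ⟨2, two_pos, by rw [pow_two, hx]⟩

/-- A group generated by involutions `p, q, r, s` with `q` central, `s = q r` and `(r p)⁴ = 1` is
finite. -/
theorem finite_of_relations {p q r s : H} (htop : Subgroup.closure {p, q, r, s} = ⊤)
    (hp : p * p = 1) (hq : q * q = 1) (hr : r * r = 1) (hpq : Commute p q) (hqr : Commute q r)
    (hs : s = q * r) (hrp : (r * p) ^ 4 = 1) : Finite H := by
  have hqu : IsOfFinOrder q := isOfFinOrder_of_mul_self hq
  have hpu : IsOfFinOrder p := isOfFinOrder_of_mul_self hp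
  have hru : IsOfFinOrder (r * p) := isOfFinOrder_iff_pow_eq_one.2 ⟨4, by norm_num, hrp⟩
  have := hqu.finite_zpowers.to_subtype
  have := hpu.finite_zpowers.to_subtype
  have := hru.finite_zpowers.to_subtype
  -- Normal form `qⁱ(rp)ʲpᵏ`, dihedral times central. Its range contains `1` and is stable under
  -- left multiplication by the generators, so it is everything.
  let f : Subgroup.zpowers q × Subgroup.zpowers (r * p) × Subgroup.zpowers p → H :=
    fun x => x.1 * (x.2.1 * x.2.2)
  have hf : ∀ i j k : ℤ, q ^ i * ((r * p) ^ j * p ^ k) ∈ Set.range f := fun i j k =>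
    ⟨⟨⟨q ^ i, i, rfl⟩, ⟨(r * p) ^ j, j, rfl⟩, ⟨p ^ k, k, rfl⟩⟩, rfl⟩
  have hpi : p⁻¹ = p := inv_eq_of_mul_eq_one_left hp
  have hri : r⁻¹ = r := inv_eq_of_mul_eq_one_left hr
  have hconj : ∀ j : ℤ, p * (r * p) ^ j = (r * p) ^ (-j) * p := by
    intro j
    have h : p * (r * p) ^ j * p⁻¹ = (r * p) ^ (-j) := by
      rw [← conj_zpow, zpow_neg, ← inv_zpow, mul_inv_rev, hri, hpi, mul_assoc, mul_assoc, hp,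
        mul_one]
    rw [← h, inv_mul_cancel_right]
  have hmulp : ∀ i j k : ℤ, p * (q ^ i * ((r * p) ^ j * p ^ k)) =
      q ^ i * ((r * p) ^ (-j) * p ^ (1 + k)) := by
    intro i j k
    rw [← mul_assoc, (hpq.zpow_right i).eq, mul_assoc, ← mul_assoc p, hconj, zpow_one_add]
    simp only [mul_assoc]
  have hmulr : ∀ i j k : ℤ, r * (q ^ i * ((r * p) ^ j * p ^ k)) =
      q ^ i * ((r * p) ^ (1 - j) * p ^ (1 + k)) := by
    intro i j k
    have h : r = r * p * p := by rw [mul_assoc, hp, mul_one]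
    have hqrp : Commute (r * p) (q ^ i) := (hqr.symm.mul_left hpq).zpow_right i
    nth_rw 1 [h]
    rw [mul_assoc, hmulp, ← mul_assoc, hqrp.eq, mul_assoc, ← mul_assoc (r * p),
      ← zpow_one_add, sub_eq_add_neg]
  have hmulq : ∀ i j k : ℤ, q * (q ^ i * ((r * p) ^ j * p ^ k)) =
      q ^ (1 + i) * ((r * p) ^ j * p ^ k) := by
    intro i j k
    rw [← mul_assoc, zpow_one_add]
  have hgen : ∀ t ∈ ({p, q, r, s} : Set H), ∀ y ∈ Set.range f, t * y ∈ Set.range f := by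
    rintro t ht _ ⟨⟨⟨_, i, rfl⟩, ⟨_, j, rfl⟩, ⟨_, k, rfl⟩⟩, rfl⟩
    change t * (q ^ i * ((r * p) ^ j * p ^ k)) ∈ _
    rcases ht with rfl | rfl | rfl | rfl
    · rw [hmulp]; exact hf _ _ _
    · rw [hmulq]; exact hf _ _ _
    · rw [hmulr]; exact hf _ _ _
    · rw [hs, mul_assoc, hmulr, hmulq]; exact hf _ _ _
  have hinv : ∀ t ∈ ({p, q, r, s} : Set H), t⁻¹ = t := by
    rintro t (rfl | rfl | rfl | rfl)
    · exact hpi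
    · exact inv_eq_of_mul_eq_one_left hq
    · exact hri
    · rw [hs, mul_inv_rev, hri, inv_eq_of_mul_eq_one_left hq, hqr.eq]
  have huniv : Set.range f = Set.univ := by
    refine Set.eq_univ_of_forall fun x => ?_
    have hx : x ∈ Subgroup.closure ({p, q, r, s} : Set H) := htop ▸ Subgroup.mem_top x
    induction hx using Subgroup.closure_induction_left with
    | one => simpa using hf 0 0 0
    | mul_left t ht y _ hy => exact hgen t ht y hy
    | inv_mul_cancel t ht y _ hy => rw [hinv t ht]; exact hgen t ht y hy
  exact Set.finite_univ_iff.1 (huniv ▸ Set.finite_range f)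

/-- The closure of a finite set of central elements of finite order is finite. -/
theorem finite_closure_of_central {S : Set H} (hS : S.Finite) (hc : S ⊆ Subgroup.center H)
    (ho : ∀ x ∈ S, IsOfFinOrder x) : Finite (Subgroup.closure S) := by
  induction S, hS using Set.Finite.induction_on with
  | empty => rw [Subgroup.closure_empty]; infer_instance
  | @insert x S _ _ ih =>
    rw [Set.insert_subset_iff] at hc
    have := ih hc.2 fun y hy => ho y (Set.mem_insert_of_mem _ hy)
    have := (ho x (Set.mem_insert _ _)).finite_zpowers.to_subtype
    let f : Subgroup.zpowers x × Subgroup.closure S → H := fun z => z.1 * z.2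
    suffices hsub : (Subgroup.closure (insert x S) : Set H) ⊆ Set.range f from
      ((Set.finite_range f).subset hsub).to_subtype
    have hN : (Subgroup.zpowers x).Normal := by
      refine ⟨fun y hy g => ?_⟩
      have hy' := Subgroup.mem_center_iff.1 ((Subgroup.zpowers_le.2 hc.1) hy) g
      rwa [hy', mul_inv_cancel_right]
    rw [Set.insert_eq, Subgroup.closure_union, ← Subgroup.zpowers_eq_closure,
      Subgroup.normal_mul]
    rintro _ ⟨y, hy, z, hz, rfl⟩
    exact ⟨⟨⟨y, hy⟩, ⟨z, hz⟩⟩, rfl⟩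

/-- The involution `x` inverts `[x,y]`; being central, the commutator equals its own inverse. -/
theorem isOfFinOrder_commutator {x y : H} (hx : x * x = 1) (hy : y * y = 1)
    (hc : ⁅x, y⁆ ∈ Subgroup.center H) : IsOfFinOrder ⁅x, y⁆ := by
  apply isOfFinOrder_of_mul_self
  have hxi : x⁻¹ = x := inv_eq_of_mul_eq_one_left hx
  have h : x * ⁅x, y⁆ * x = ⁅x, y⁆⁻¹ := by
    rw [commutatorElement_inv, commutatorElement_def, commutatorElement_def, hxi,
      inv_eq_of_mul_eq_one_left hy, ← mul_assoc, ← mul_assoc, ← mul_assoc, hx, one_mul]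
  rw [Subgroup.mem_center_iff.1 hc, mul_assoc, hx, mul_one] at h
  nth_rw 1 [h]
  rw [inv_mul_cancel]

/-- Centrality permits the rotation `qrs = rsq`, so `(qrs)² = rsq·qrs = [r,s]`. -/
theorem isOfFinOrder_mul_mul {q r s : H} (hq : q * q = 1) (hr : r * r = 1) (hs : s * s = 1)
    (hc : q * r * s ∈ Subgroup.center H) (ho : IsOfFinOrder ⁅r, s⁆) :
    IsOfFinOrder (q * r * s) := by
  have h1 : r * s * q = q * r * s := by
    have h := Subgroup.mem_center_iff.1 hc q
    rw [← mul_assoc, ← mul_assoc, hq, one_mul] at h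
    rw [← mul_left_inj q, ← h, mul_assoc, hq, mul_one]
  have h2 : (q * r * s) ^ 2 = ⁅r, s⁆ := by
    nth_rw 1 [pow_two, ← h1]
    rw [commutatorElement_def, inv_eq_of_mul_eq_one_left hr, inv_eq_of_mul_eq_one_left hs,
      mul_assoc, ← mul_assoc q, ← mul_assoc q, hq, one_mul, ← mul_assoc]
  rw [← h2] at ho
  exact ho.of_pow two_ne_zero

end Finiteness

theorem closure_map_generators (N : Subgroup G) [N.Normal] :
    Subgroup.closure {QuotientGroup.mk' N a, QuotientGroup.mk' N b, QuotientGroup.mk' N c,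
      QuotientGroup.mk' N d} = ⊤ := by
  have h := congrArg (Subgroup.map (QuotientGroup.mk' N)) closure_generators
  rwa [MonoidHom.map_closure, Subgroup.map_top_of_surjective _ (QuotientGroup.mk'_surjective N),
    Set.image_insert_eq, Set.image_insert_eq, Set.image_insert_eq, Set.image_singleton] at h

theorem finite_quotient_K : Finite (G ⧸ K) := by
  have hsq : ∀ {g : G}, g * g = 1 → QuotientGroup.mk' K g * QuotientGroup.mk' K g = 1 :=
    fun h => by rw [← map_mul, h, map_one]
  have hqr := commute_mk.2 commutator_b_c_mem_K
  have hs : QuotientGroup.mk' K d = QuotientGroup.mk' K b * QuotientGroup.mk' K c := by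
    have h := mk_eq_one.2 b_mul_c_mul_d_mem_K
    rw [map_mul, map_mul, mul_eq_one_iff_eq_inv, inv_eq_of_mul_eq_one_left (hsq d_mul_self)] at h
    exact h.symm
  refine finite_of_relations (closure_map_generators K) (hsq a_mul_self) (hsq b_mul_self)
    (hsq c_mul_self) (commute_mk.2 commutator_a_b_mem_K) hqr hs ?_
  -- Modulo `K`, `aca` commutes with `d` and `b`, hence with `c = bd`; so `(ca)² = c·aca` is a
  -- product of commuting involutions.
  have h : Commute (QuotientGroup.mk' K (a * c * a)) (QuotientGroup.mk' K d) :=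
    commute_mk.2 (commutator_aca_d ▸ commutator_b_d_mem_K)
  have hb : Commute (QuotientGroup.mk' K (a * c * a)) (QuotientGroup.mk' K b) := by
    rw [map_mul, map_mul]
    exact ((commute_mk.2 commutator_a_b_mem_K).mul_left hqr.symm).mul_left
      (commute_mk.2 commutator_a_b_mem_K)
  have hc : QuotientGroup.mk' K c = QuotientGroup.mk' K b * QuotientGroup.mk' K d := by
    rw [hs, ← mul_assoc, hsq b_mul_self, one_mul]
  have hac : Commute (QuotientGroup.mk' K (a * c * a)) (QuotientGroup.mk' K c) :=
    hc ▸ hb.mul_right h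
  have h1 : (a * c * a) * (a * c * a) = 1 := by
    rw [show (a * c * a) * (a * c * a) = a * c * (a * a) * c * a by simp only [mul_assoc],
      a_mul_self, mul_one, mul_assoc a c c, c_mul_self, mul_one, a_mul_self]
  have h2 : QuotientGroup.mk' K c * QuotientGroup.mk' K a * (QuotientGroup.mk' K c *
      QuotientGroup.mk' K a) = QuotientGroup.mk' K c * QuotientGroup.mk' K (a * c * a) := by
    simp only [map_mul, mul_assoc]
  rw [show 4 = 2 + 2 from rfl, pow_add, pow_two, h2, mul_assoc,
    ← mul_assoc _ _ (QuotientGroup.mk' K (a * c * a)), hac.eq, mul_assoc,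
    hsq h1, mul_one, hsq c_mul_self]

theorem C_le_K : C ≤ K := by
  rw [C, sup_le_iff, Subgroup.zpowers_le]
  exact ⟨Subgroup.commutator_le_left _ _, mul_mem commutator_a_b_mem_K commutator_b_c_mem_K⟩

theorem commutator_mem_C {k : G} (hk : k ∈ K) (g : G) : ⁅k, g⁆ ∈ C :=
  Subgroup.mem_sup_left (Subgroup.commutator_mem_commutator hk (Subgroup.mem_top g))

instance C_normal : C.Normal := by
  refine ⟨fun x hx g => ?_⟩
  have h : ⁅g, x⁆ ∈ C := by
    rw [← commutatorElement_inv]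
    exact inv_mem (commutator_mem_C (C_le_K hx) g)
  simpa [commutatorElement_def, mul_assoc] using mul_mem h hx

/-- Since `[K,G] ≤ C`, the image of `K` is central, so the images of the normal generators already
generate it as a group. -/
theorem finite_map_K : Finite (K.map (QuotientGroup.mk' C)) := by
  have hc : ∀ k ∈ K, QuotientGroup.mk' C k ∈ Subgroup.center (G ⧸ C) := by
    intro k hk
    rw [Subgroup.mem_center_iff]
    intro g
    obtain ⟨g, rfl⟩ := QuotientGroup.mk'_surjective C g
    exact (commute_mk.2 (commutator_mem_C hk g)).eq.symm
  have hsq : ∀ {g : G}, g * g = 1 → QuotientGroup.mk' C g * QuotientGroup.mk' C g = 1 :=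
    fun h => by rw [← map_mul, h, map_one]
  have hcomm : ∀ {g h : G}, g * g = 1 → h * h = 1 → ⁅g, h⁆ ∈ K →
      IsOfFinOrder (QuotientGroup.mk' C ⁅g, h⁆) := by
    intro g h hg hh hk
    have := hc _ hk
    rw [map_commutatorElement] at this ⊢
    exact isOfFinOrder_commutator (hsq hg) (hsq hh) this
  have hfin : Finite (Subgroup.closure (QuotientGroup.mk' C ''
      {⁅a, b⁆, ⁅b, c⁆, ⁅b, d⁆, ⁅c, d⁆, b * c * d})) := by
    refine finite_closure_of_central (Set.toFinite _) ?_ ?_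
    · rintro _ ⟨k, hk, rfl⟩
      exact hc k (Subgroup.subset_normalClosure hk)
    · rintro _ ⟨k, hk, rfl⟩
      rcases hk with rfl | rfl | rfl | rfl | rfl
      · exact hcomm a_mul_self b_mul_self commutator_a_b_mem_K
      · exact hcomm b_mul_self c_mul_self commutator_b_c_mem_K
      · exact hcomm b_mul_self d_mul_self commutator_b_d_mem_K
      · exact hcomm c_mul_self d_mul_self commutator_c_d_mem_K
      · have h1 := hcomm c_mul_self d_mul_self commutator_c_d_mem_K
        have h2 := hc _ b_mul_c_mul_d_mem_K
        rw [map_commutatorElement] at h1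
        rw [map_mul, map_mul] at h2 ⊢
        exact isOfFinOrder_mul_mul (hsq b_mul_self) (hsq c_mul_self) (hsq d_mul_self) h2 h1
  have hN : (Subgroup.closure (QuotientGroup.mk' C ''
      {⁅a, b⁆, ⁅b, c⁆, ⁅b, d⁆, ⁅c, d⁆, b * c * d})).Normal := by
    refine ⟨fun x hx g => ?_⟩
    have hx' : x ∈ Subgroup.center (G ⧸ C) := by
      refine (Subgroup.closure_le _).2 ?_ hx
      rintro _ ⟨k, hk, rfl⟩
      exact hc k (Subgroup.subset_normalClosure hk)
    rwa [Subgroup.mem_center_iff.1 hx' g, mul_inv_cancel_right]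
  have hle : K.map (QuotientGroup.mk' C) ≤ Subgroup.closure (QuotientGroup.mk' C ''
      {⁅a, b⁆, ⁅b, c⁆, ⁅b, d⁆, ⁅c, d⁆, b * c * d}) := by
    rw [Subgroup.map_le_iff_le_comap]
    exact Subgroup.normalClosure_le_normal fun k hk => Subgroup.subset_closure ⟨k, hk, rfl⟩
  exact Finite.of_injective _ (Subgroup.inclusion_injective hle)

theorem index_C_ne_zero : C.index ≠ 0 := by
  rw [← Subgroup.relIndex_mul_index C_le_K]
  refine mul_ne_zero ?_ (Subgroup.index_ne_zero_iff_finite.2 finite_quotient_K)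
  have := finite_map_K
  have h : C.relIndex K = (⊥ : Subgroup (G ⧸ C)).relIndex (K.map (QuotientGroup.mk' C)) := by
    rw [← Subgroup.relIndex_comap, MonoidHom.comap_bot, QuotientGroup.ker_mk']
  rw [h, Subgroup.relIndex_bot_left]
  exact Nat.card_pos.ne'

theorem relIndex_CAut_ne_zero : CAut.relIndex G ≠ 0 := by
  rw [Subgroup.relIndex, Subgroup.subgroupOf, Subgroup.comap_map_eq_self_of_injective
    G.subtype_injective]
  exact index_C_ne_zero

/-! ### Translates of subgroups of finite index -/

/-- The homomorphism that maps `(g, h)` to the automorphism with sections `g` and `h`. -/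
def belowProd : G × G →* AutTree :=
  MonoidHom.noncommCoprod ((below false).comp G.subtype) ((below true).comp G.subtype) fun g h => by
    have h1 := (hasSection_below_ne (x := true) (y := false) (by decide) (h : AutTree)).conj_below g
    rw [one_mul, inv_one, mul_one, mul_inv_eq_iff_eq_mul] at h1
    exact h1.symm

/-- The stabiliser of the vertex `0`. -/
def stabilizerZero : Subgroup AutTree where
  carrier := {g | g [false] = [false]}
  one_mem' := rfl
  mul_mem' {g h} hg hh := (congrArg g hh).trans hg
  inv_mem' {g} hg := by
    change g⁻¹ [false] = [false]
    apply g.injective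
    rw [RelIso.apply_inv_self]
    exact hg.symm

theorem section_letters_ne {g s t : AutTree} {y z : Bool} (hs : HasSection g false y s)
    (ht : HasSection g true z t) : y ≠ z := by
  rintro rfl
  have h : g [false] = g [true] := by rw [hs, ht, apply_nil, apply_nil]
  simpa using g.injective h

theorem relIndex_stabilizerZero_ne_zero : stabilizerZero.relIndex G ≠ 0 := by
  suffices h : stabilizerZero.relIndex G = 2 by rw [h]; decide
  rw [Subgroup.relIndex_eq_two_iff]
  refine ⟨State.a.toAut, toAut_mem_G .a, fun g hg => ?_⟩
  obtain ⟨y, s, -, hs⟩ := exists_section_mem hg false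
  obtain ⟨z, t, -, ht⟩ := exists_section_mem hg true
  have hyz := section_letters_ne hs ht
  have h1 : g ∈ stabilizerZero ↔ y = false := by
    change g [false] = [false] ↔ _
    rw [hs, apply_nil]
    simp
  have h2 : g * State.a.toAut ∈ stabilizerZero ↔ z = false := by
    change g [true] = [false] ↔ _
    rw [ht, apply_nil]
    simp
  rw [h1, h2]
  revert hyz
  cases y <;> cases z <;> simp [Xor]

theorem inf_stabilizerZero_le : stabilizerZero ⊓ G ≤ belowProd.range := by
  rintro g ⟨hg0, hg⟩
  obtain ⟨y, s, hsG, hs⟩ := exists_section_mem hg false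
  obtain ⟨z, t, htG, ht⟩ := exists_section_mem hg true
  have hyz := section_letters_ne hs ht
  have hy : y = false := by
    have h : g [false] = [false] := hg0
    rw [hs] at h
    exact (List.cons_eq_cons.1 h).1
  subst hy
  have hz : z = true := by cases z <;> simp_all
  subst hz
  refine ⟨(⟨s, hsG⟩, ⟨t, htG⟩), ?_⟩
  change below false s * below true t = g
  refine ext_sections ?_ hs ?_ ht
  · simpa using (hasSection_below_same false s).mul
      (hasSection_below_ne (x := true) (y := false) (by decide) t)
  · simpa using (hasSection_below_ne (x := false) (y := true) (by decide) s).mul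
      (hasSection_below_same true t)

/-- The subgroup `X * H`. -/
def spread (H : Subgroup AutTree) : Subgroup AutTree :=
  H.map (below false) ⊔ H.map (below true)

/-- `X * H` contains the image of a finite-index subgroup of `G × G`, and that of `G × G` contains
the stabiliser of `0` in `G`. -/
theorem relIndex_spread_ne_zero {H : Subgroup AutTree} (hH : H.relIndex G ≠ 0) :
    (spread H).relIndex G ≠ 0 := by
  set P : Subgroup (G × G) := (H.subgroupOf G).prod (H.subgroupOf G)
  have hP : P.index ≠ 0 := by
    rw [Subgroup.index_prod]
    exact mul_ne_zero hH hH
  have hle : P.map belowProd ≤ spread H := by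
    rintro _ ⟨⟨g, h⟩, ⟨hg, hh⟩, rfl⟩
    exact mul_mem (Subgroup.mem_sup_left ⟨g, hg, rfl⟩) (Subgroup.mem_sup_right ⟨h, hh, rfl⟩)
  have h1 : (P.map belowProd).relIndex belowProd.range ≠ 0 := by
    rw [MonoidHom.range_eq_map, Subgroup.relIndex_map_map, top_sup_eq, Subgroup.relIndex_top_right]
    exact ne_zero_of_dvd_ne_zero hP (Subgroup.index_dvd_of_le le_sup_left)
  have h2 : (spread H).relIndex (stabilizerZero ⊓ G) ≠ 0 := fun h =>
    h1 (Subgroup.relIndex_eq_zero_of_le_left hle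
      (Subgroup.relIndex_eq_zero_of_le_right inf_stabilizerZero_le h))
  refine Subgroup.relIndex_ne_zero_trans h2 ?_
  rw [Subgroup.inf_relIndex_right]
  exact relIndex_stabilizerZero_ne_zero

theorem map_below_levelTranslate_le (x : Bool) (n : ℕ) (H : Subgroup AutTree) :
    (levelTranslate n H).map (below x) ≤ levelTranslate (n + 1) H := by
  rw [levelTranslate, Subgroup.map_iSup]
  refine iSup_le fun v => ?_
  rw [Subgroup.map_map]
  exact le_iSup (fun v : {v : List Bool // v.length = n + 1} => H.map (translate v.1))
    ⟨x :: v.1, by simp [v.2]⟩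

theorem relIndex_levelTranslate_ne_zero {H : Subgroup AutTree} (hH : H.relIndex G ≠ 0) (n : ℕ) :
    (levelTranslate n H).relIndex G ≠ 0 := by
  induction n with
  | zero =>
    refine fun h => hH (Subgroup.relIndex_eq_zero_of_le_left ?_ h)
    refine le_trans ?_ (le_iSup (fun v : {v : List Bool // v.length = 0} => H.map (translate v.1))
      ⟨[], rfl⟩)
    exact (Subgroup.map_id H).ge
  | succ n ih =>
    exact fun h => relIndex_spread_ne_zero ih (Subgroup.relIndex_eq_zero_of_le_left
      (sup_le (map_below_levelTranslate_le _ n H) (map_below_levelTranslate_le _ n H)) h)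

theorem finiteIndex_of_normal {N : Subgroup G} (hN : N.Normal) (hN' : N ≠ ⊥) : N.FiniteIndex := by
  obtain ⟨n, hn⟩ := exists_levelTranslate_le hN hN'
  refine ⟨fun h => relIndex_levelTranslate_ne_zero relIndex_CAut_ne_zero n
    (Subgroup.relIndex_eq_zero_of_le_left (hn n le_rfl) ?_)⟩
  rwa [Subgroup.relIndex, Subgroup.subgroupOf, Subgroup.comap_map_eq_self_of_injective
    G.subtype_injective]

/-! ### Infinitude of `G` -/

theorem below_injective (x : Bool) : Function.Injective (below x) := by
  intro g h hgh
  ext1 w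
  have := congrArg (fun k : AutTree => k (x :: w)) hgh
  simpa [below_cons_same] using this

theorem infinite_G : Infinite G := by
  by_contra hfin
  rw [not_infinite_iff_finite] at hfin
  let f : KAut → KAut := fun k => ⟨below true k, KAut_le_pull k.2⟩
  have hf : Function.Injective f := fun g h hgh =>
    Subtype.ext (below_injective true (congrArg Subtype.val hgh))
  have : Finite KAut := Finite.of_injective _ (Subgroup.inclusion_injective KAut_le_G)
  obtain ⟨k, hk⟩ := Finite.surjective_of_injective hf ⟨_, _, commutator_a_b_mem_K, rfl⟩
  -- Translates below `1` fix the word `00`, whereas `[a,b]` maps it to `01`.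
  have h := congrArg (fun k : KAut => (k : AutTree) [false, false]) hk
  change below true k [false, false] = ⁅State.a.toAut, State.b.toAut⁆ [false, false] at h
  rw [below_cons_ne (by decide), commutatorElement_def, State.toAut_inv, State.toAut_inv] at h
  exact absurd h (by decide)

end TwistedTwin

theorem mainTheorem6 :
    TwistedTwin.IsJustInfinite TwistedTwin.G ∧
      ∀ N : Subgroup TwistedTwin.G, N.Normal → N ≠ ⊥ →
        ∃ n₀ : ℕ, ∀ n : ℕ, n₀ ≤ n →
          TwistedTwin.levelTranslate n (TwistedTwin.C.map TwistedTwin.G.subtype) ≤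
            N.map TwistedTwin.G.subtype :=
  ⟨⟨TwistedTwin.infinite_G, fun _ hN hN' => TwistedTwin.finiteIndex_of_normal hN hN'⟩,
    fun _ hN hN' => TwistedTwin.exists_levelTranslate_le hN hN'⟩
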